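/- Consider $M$ qubits, one at each vertex of a finite graph $G$ (for instance a regular lattice with $M=N^D$ sites), with Hilbert space $H=(\mathbb C^2)^{\otimes M}$ and $|\mathbf 0\rangle=|0\rangle^{\otimes M}$. Every site may carry further ancilla qubits in the state $|0\rangle$. A local unitary (LU) is a tensor product of one unitary per site, acting on all the qubits of that site. A depth-$\ell$ circuit is a product $U_\ell V_\ell\cdots U_1V_1U_0$, where each $U_n$ is an LU and each layer $V_n$ is a product of two-qubit gates acting on disjoint pairs of nearest-neighbour spins (not on the ancillas). A state $|\varphi\rangle\in H$ can be prepared by $\mathrm{QCcc}_\ell$ if, for some number of ancillas per site, a depth-$\ell$ circuit is applied to $|\mathbf 0\rangle$, then the ancillas are measured site by site (at most once per site, each time in an orthonormal basis of the ancillas of that site), each measurement being followed by an LU that may depend on all earlier outcomes, and for all outcomes the spins end up in $|\varphi\rangle$. The set $\mathcal{QC}\mathrm{cc}_\ell$ consists of the unitaries $U$ on $H$ for which there are a state $|\varphi\rangle$ of one ancilla per site that can be prepared by $\mathrm{QCcc}_\ell$, further ancillas in $|0\rangle$, a depth-$\ell$ circuit $C$ on spins and ancillas, local orthonormal bases $\{|\alpha_v\rangle\}$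 of the ancillas of each site $v$, and LUs $W^{\alpha}$ on the spins, such that for all outcomes $\alpha$ there is $c_\alpha\in\mathbb C$ with $W^\alpha(\otimes_v\langle\alpha_v|)\,C\,(|\psi\rangle\otimes|\varphi\rangle\otimes|0\cdots0\rangle)=c_\alpha U|\psi\rangle$ for every $|\psi\rangle\in H$. Let $\mathcal Q$ be the set of tensor products of the Pauli matrices $1,\sigma^x,\sigma^y,\sigma^z$. A unit vector of $H$ is a stabilizer state if it is, up to a scalar, the unique common eigenvector, with certain eigenvalues, of a set of commuting elements of $\mathcal Q$. A unitary $U$ is Clifford if for every $s\in\mathcal Q$ the operator $U^\dagger sU$ is, up to a factor, in $\mathcal Q$. Let $\ell\ge 0$ and let $|\phi\rangle\in H$ be a stabilizer state that can be prepared by $\mathrm{QCcc}_\ell$. Then there are an LU $T$ on the spins and one ancilla per site, and a Clifford unitary $U$ on $H$, such that: (1) $|R\rangle=T(|\phi\rangle\otimes|\mathbf 0\rangle)$ is maximally entangled between spins and ancillas, i.e. $\mathrm{tr}_{\rm anc}|R\rangle\langle R|=2^{-M}\,1$; (2) $|R\rangle$ is the Choi state of $U$, i.e. $|R\rangle=(U\otimes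 1)\bigotimes_v|\Phi^+\rangle_v$ with $|\Phi^+\rangle=(|00\rangle+|11\rangle)/\sqrt2$; (3) $U\in\mathcal{QC}\mathrm{cc}_\ell$; (4) $U$ is implemented deterministically by Bell measurements and Pauli corrections: let the input qubits $s$ be in the state $|\psi\rangle$ and the ancillas $a,a'$ in the state $|R\rangle_{a,a'}$, and let the pair $(s_v,a'_v)$ be measured at each site $v$ in the Bell basis $|\Phi^{\alpha}\rangle=(\sigma^{\alpha}\otimes1)|\Phi^+\rangle$, $\alpha\in\{0,x,y,z\}$. Then for every tuple of outcomes $(\alpha_v)$ there are $w\in\mathcal Q$ and $c\in\mathbb C$ with $|c|=1$ such that, for every $|\psi\rangle\in H$, $$w\,\Big(\bigotimes_v\langle\Phi^{\alpha_v}|_{s_v,a'_v}\Big)\big(|\psi\rangle_s\otimes|R\rangle_{a,a'}\big)=2^{-M}c\,U|\psi\rangle_a .$$ -/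

import Mathlib

noncomputable section

namespace QCLOCC

open Matrix

/-- Vectors of the Hilbert space of a system whose sites are `V` and whose local Hilbert space has
computational basis `L`. (One qubit per site: `L = Fin 2`; one qubit and its ancillas per site:
`L = Fin 2 × A`, with `A` the computational basis of the ancillas of a site.) -/
abbrev State (V L : Type*) := (V → L) → ℂ

/-- Operators on the same space. -/
abbrev Op (V L : Type*) := Matrix (V → L) (V → L) ℂ

section Basic

variable {V L A : Type*} [Fintype V] [DecidableEq V] [Fintype L] [DecidableEq L]
  [Fintype A] [DecidableEq A]

/-- Unit vectors. -/
def IsNormalized (φ : State V L) : Prop := ∑ x, ‖φ x‖ ^ 2 = 1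

/-- The tensor product of one operator per site. -/
def tensorOp (u : V → Matrix L L ℂ) : Op V L := fun x y => ∏ v, u v (x v) (y v)

/-- Local unitaries: tensor products of unitaries, each acting on one site (the spin and all the
ancillas of the site, if there are any). -/
def IsLU (W : Op V L) : Prop :=
  ∃ u : V → Matrix L L ℂ, (∀ v, u v ∈ unitaryGroup L ℂ) ∧ W = tensorOp u

/-- `X ⊗ 1`: an operator on the spins, acting on spins and ancillas. -/
def onSpins (X : Op V (Fin 2)) : Op V (Fin 2 × A) := fun x y =>
  X (fun v => (x v).1) (fun v => (y v).1) *
    (if (fun v => (x v).2) = (fun v => (y v).2) then 1 else 0)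

/-- The product vector `φ ⊗ χ` of a vector of the spins and a vector of the ancillas. -/
def tensorState (φ : State V (Fin 2)) (χ : State V A) : State V (Fin 2 × A) := fun x =>
  φ (fun v => (x v).1) * χ (fun v => (x v).2)

/-- The product state in which every site is in the computational basis state `l`. -/
def productState (l : L) : State V L := fun x => if x = fun _ => l then 1 else 0

end Basic

section Circuits

variable {V A : Type*} [Fintype V] [DecidableEq V] [Fintype A] [DecidableEq A]

/-- A two-qubit gate on a pair of nearest neighbours, i.e. adjacent vertices of the graph `G`. -/
structure Gate (G : SimpleGraph V) where
  fst : V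
  snd : V
  adj : G.Adj fst snd
  mat : Matrix (Fin 2 × Fin 2) (Fin 2 × Fin 2) ℂ
  unitary : mat ∈ unitaryGroup (Fin 2 × Fin 2) ℂ

/-- The operator on all the spins defined by a gate. -/
def Gate.toOp {G : SimpleGraph V} (g : Gate G) : Op V (Fin 2) := fun x y =>
  if ∀ v, v ≠ g.fst → v ≠ g.snd → x v = y v then
    g.mat (x g.fst, x g.snd) (y g.fst, y g.snd)
  else 0

/-- The sites on which a gate acts. -/
def Gate.sites {G : SimpleGraph V} (g : Gate G) : Finset V := {g.fst, g.snd}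

/-- A layer: a product of gates on disjoint pairs of nearest neighbours. -/
def IsLayer (G : SimpleGraph V) (W : Op V (Fin 2)) : Prop :=
  ∃ gs : List (Gate G), gs.Pairwise (fun g h => Disjoint g.sites h.sites) ∧
    W = (gs.map Gate.toOp).prod

/-- Depth-`ℓ` quantum circuits with ancillas, `U_ℓ V_ℓ ⋯ U_1 V_1 U_0`: the `V_n` are layers acting
on the spins and the `U_n` are local unitaries acting on spins and ancillas. -/
inductive IsCircuit (G : SimpleGraph V) : ℕ → Op V (Fin 2 × A) → Prop
  | zero (U : Op V (Fin 2 × A)) : IsLU U → IsCircuit G 0 U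
  | succ (ℓ : ℕ) (C U : Op V (Fin 2 × A)) (W : Op V (Fin 2)) :
      IsCircuit G ℓ C → IsLayer G W → IsLU U → IsCircuit G (ℓ + 1) (U * onSpins W * C)

end Circuits

section StatePreparation

variable {V A : Type*} [Fintype V] [DecidableEq V] [Fintype A] [DecidableEq A]

/-- The projection `|b⟩⟨b|` on the ancillas of the site `v`: the unnormalised state after a
measurement of these ancillas with outcome `b`. -/
def projectAncilla (v : V) (b : A → ℂ) (Ψ : State V (Fin 2 × A)) : State V (Fin 2 × A) := fun x =>
  b (x v).2 * ∑ a : A, star (b a) * Ψ (Function.update x v ((x v).1, a))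

/-- The ancillas of the sites in the list are measured one site after the other, each in an
orthonormal basis (the columns of the unitary `B`); after each measurement a local unitary is
applied, which may depend on all outcomes so far. On every branch the spins end up in the state
`φ`, in a product with the ancillas. Branches are unnormalised, so that a branch that vanishes has
probability zero. -/
def LOCCPrepares (φ : State V (Fin 2)) : List V → State V (Fin 2 × A) → Prop
  | [], Ψ => ∃ χ : State V A, Ψ = tensorState φ χ
  | v :: vs, Ψ => ∃ B ∈ unitaryGroup A ℂ, ∀ k : A, ∃ W : Op V (Fin 2 × A), IsLU W ∧
      LOCCPrepares φ vs (W *ᵥ projectAncilla v (fun a => B a k) Ψ)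

/-- `φ` can be prepared by QCcc_`ℓ`: for some number `k` of ancilla qubits per site there is a
depth-`ℓ` circuit on spins and ancillas which, applied to `|0⟩`, gives a state that is
deterministically transformed into `φ` by at most one measurement of ancillas per site. -/
def PreparableQCcc (G : SimpleGraph V) (ℓ : ℕ) (φ : State V (Fin 2)) : Prop :=
  IsNormalized φ ∧ ∃ (k : ℕ) (C : Op V (Fin 2 × (Fin k → Fin 2))) (order : List V),
    IsCircuit G ℓ C ∧ order.Nodup ∧
      LOCCPrepares φ order (C *ᵥ productState (0, fun _ => 0))

end StatePreparation

section Unitaries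

variable {V A : Type*} [Fintype V] [DecidableEq V] [Fintype A] [DecidableEq A]

/-- `⊗ᵥ ⟨b v|` applied to the ancillas: the unnormalised state of the spins after the outcome `b v`
has been found in a measurement of the ancillas of each site `v`. -/
def braAncillas (b : V → A → ℂ) (Ψ : State V (Fin 2 × A)) : State V (Fin 2) := fun s =>
  ∑ a : V → A, (∏ v, star (b v (a v))) * Ψ (fun v => (s v, a v))

/-- The set `𝒬𝒞cc_ℓ` of unitaries `U` on the spins that are implemented deterministically by
`ψ ↦ U^α (⊗ᵥ ⟨α v|) C (ψ ⊗ φ ⊗ |0⟩)`: here `φ` is a state of one ancilla per site that can be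
prepared by QCcc_`ℓ`, there are `k` further ancillas per site in the state `|0⟩`, `C` is a
depth-`ℓ` circuit on spins and ancillas, the ancillas of the site `v` are measured in the
orthonormal basis formed by the columns of `B v`, and the local unitary `W α` may depend on the
outcomes `α`. Whatever the outcomes, the result is proportional to `U ψ`. -/
def UnitaryQCcc (G : SimpleGraph V) (ℓ : ℕ) : Set (Op V (Fin 2)) :=
  {U | U ∈ unitaryGroup (V → Fin 2) ℂ ∧
    ∃ φ : State V (Fin 2), PreparableQCcc G ℓ φ ∧
    ∃ (k : ℕ) (C : Op V (Fin 2 × (Fin 2 × (Fin k → Fin 2))))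
      (B : V → Matrix (Fin 2 × (Fin k → Fin 2)) (Fin 2 × (Fin k → Fin 2)) ℂ)
      (W : (V → Fin 2 × (Fin k → Fin 2)) → Op V (Fin 2)),
      IsCircuit G ℓ C ∧ (∀ v, B v ∈ unitaryGroup (Fin 2 × (Fin k → Fin 2)) ℂ) ∧
      (∀ α, IsLU (W α)) ∧
      ∀ α, ∃ c : ℂ, ∀ ψ : State V (Fin 2),
        W α *ᵥ braAncillas (fun v a => B v a (α v))
          (C *ᵥ tensorState ψ (tensorState φ (productState (fun _ => 0)))) = c • (U *ᵥ ψ)}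

end Unitaries

/-- Labels of the Pauli matrices. -/
inductive Pauli
  | I | X | Y | Z

/-- The Pauli matrices. -/
def Pauli.mat : Pauli → Matrix (Fin 2) (Fin 2) ℂ
  | .I => !![1, 0; 0, 1]
  | .X => !![0, 1; 1, 0]
  | .Y => !![0, -Complex.I; Complex.I, 0]
  | .Z => !![1, 0; 0, -1]

section Pauli

variable {V : Type*} [Fintype V] [DecidableEq V]

/-- Tensor products of Pauli matrices. -/
def pauliString (p : V → Pauli) : Op V (Fin 2) := tensorOp fun v => (p v).mat

/-- `φ` is a stabilizer state: there are commuting Pauli strings of which it is the unique (up to a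
scalar) common eigenvector for certain eigenvalues. -/
def IsStabilizerState (φ : State V (Fin 2)) : Prop :=
  IsNormalized φ ∧ ∃ (S : Set (V → Pauli)) (ev : (V → Pauli) → ℂ),
    (∀ p ∈ S, ∀ q ∈ S, Commute (pauliString p) (pauliString q)) ∧
    (∀ p ∈ S, pauliString p *ᵥ φ = ev p • φ) ∧
    ∀ ψ : State V (Fin 2), (∀ p ∈ S, pauliString p *ᵥ ψ = ev p • ψ) → ∃ c : ℂ, ψ = c • φ

/-- Clifford unitaries: `U† s U` is a Pauli string, up to a factor, for every Pauli string `s`. -/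
def IsClifford (U : Op V (Fin 2)) : Prop :=
  U ∈ unitaryGroup (V → Fin 2) ℂ ∧
    ∀ p : V → Pauli, ∃ (q : V → Pauli) (c : ℂ), Uᴴ * pauliString p * U = c • pauliString q

/-- `tr_a |R⟩⟨R|` for a state `R` of one spin and one ancilla per site. -/
def traceAncillas (R : State V (Fin 2 × Fin 2)) : Op V (Fin 2) := fun s t =>
  ∑ a : V → Fin 2, R (fun v => (s v, a v)) * star (R (fun v => (t v, a v)))

/-- `R` is maximally entangled between spins and ancillas: the spins are maximally mixed. -/
def IsMaximallyEntangled (R : State V (Fin 2 × Fin 2)) : Prop :=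
  traceAncillas R = ((1 : ℂ) / 2 ^ Fintype.card V) • (1 : Op V (Fin 2))

/-- The Bell basis `(σ ⊗ 1)|Φ⁺⟩`, where `|Φ⁺⟩ = (|00⟩ + |11⟩)/√2`. -/
def bell (p : Pauli) : Fin 2 × Fin 2 → ℂ := fun x => p.mat x.1 x.2 / (Real.sqrt 2 : ℂ)

/-- The Choi state `(U ⊗ 1) ⊗ᵥ |Φ⁺⟩` of `U`, the ancillas being the second factor. -/
def choiState (U : Op V (Fin 2)) : State V (Fin 2 × Fin 2) :=
  onSpins U *ᵥ fun x => ∏ v, bell Pauli.I (x v)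

/-- Each site has an input qubit `s` and two ancillas `a`, `a'`; the inputs are in the state `ψ` and
the ancillas in the state `R`. A Bell measurement is made on `s` and `a'` at each site `v`, with
outcome `α v`. This is the resulting unnormalised state of the qubits `a`. -/
def afterBellMeasurement (R : State V (Fin 2 × Fin 2)) (α : V → Pauli) (ψ : State V (Fin 2)) :
    State V (Fin 2) := fun a =>
  ∑ s : V → Fin 2, ∑ a' : V → Fin 2,
    (∏ v, star (bell (α v) (s v, a' v))) * (ψ s * R (fun v => (a v, a' v)))

end Pauli

end QCLOCC

end

open QCLOCC

set_option linter.unusedSectionVars false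

noncomputable section

namespace QCLOCC

open Matrix

/-! ### Algebra of tensor products of one-site operators. -/

section LocalOperators

variable {V L : Type*} [Fintype V] [DecidableEq V] [Fintype L] [DecidableEq L]

/-! A stabilizer state is locally equivalent to a state with flat amplitudes whose phases are
quadratic, and such a state encodes a diagonal Clifford unitary.

At each site choose `X` or `Z` so that no nontrivial product of the chosen matrices stabilizes `φ`
(`exists_basis_avoiding_stabilizers`); Hadamards turn these products into `Z`-strings and `φ` into
`χ`. A Pauli string has expectation value zero unless it is a stabilizer, and expectation values of
`Z ^ b * X ^ a` are Fourier coefficients of `x ↦ star (χ x) * χ (x + a)`. For `a = 0` only `b = 0`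
survives, so `|χ|²` is constant. For general `a` the function is therefore nonzero, so some `b`
gives a stabilizer, which says that `χ (x + a)` is `χ x` times a character and a constant
(`IsStabilizerState.exists_isQuadraticPhase`).

Let `g` be `χ` rescaled to modulus 1 and `U = diagonal g`. Translating `g` costs only a character,
so `U` is Clifford. Copying each spin to an ancilla by a CNOT turns `χ` into the Choi state of `U`.
Adding the input to ancillas in the state `χ` and measuring these implements `U` up to a `Z`-string,
so the preparation of `φ` is the only nonlocal resource. -/

theorem tensorOp_mul (u w : V → Matrix L L ℂ) :
    tensorOp u * tensorOp w = tensorOp fun v => u v * w v := by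
  ext x y
  simp only [tensorOp, Matrix.mul_apply, Finset.prod_univ_sum, Fintype.piFinset_univ,
    Finset.prod_mul_distrib]

theorem tensorOp_one : tensorOp (fun _ : V => (1 : Matrix L L ℂ)) = 1 := by
  ext x y
  simp only [tensorOp, Matrix.one_apply, Finset.prod_ite_zero, Finset.prod_const_one,
    Finset.mem_univ, true_imp_iff, funext_iff]

theorem tensorOp_smul (c : V → ℂ) (u : V → Matrix L L ℂ) :
    tensorOp (fun v => c v • u v) = (∏ v, c v) • tensorOp u := by
  ext x y
  simp [tensorOp, Finset.prod_mul_distrib]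

theorem tensorOp_conjTranspose (u : V → Matrix L L ℂ) :
    (tensorOp u)ᴴ = tensorOp fun v => (u v)ᴴ := by
  ext x y
  simp [tensorOp, Matrix.conjTranspose_apply]

theorem IsLU.one : IsLU (1 : Op V L) :=
  ⟨fun _ => 1, fun _ => one_mem _, tensorOp_one.symm⟩

theorem tensorOp_conjTranspose_mul_self {u : V → Matrix L L ℂ}
    (hu : ∀ v, u v ∈ unitaryGroup L ℂ) : (tensorOp u)ᴴ * tensorOp u = 1 := by
  rw [tensorOp_conjTranspose, tensorOp_mul, ← tensorOp_one]
  congr 1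
  funext v
  exact mem_unitaryGroup_iff'.mp (hu v)

theorem sum_fun_prod {A : Type*} [Fintype A] (f : (V → L × A) → ℂ) :
    ∑ y, f y = ∑ s : V → L, ∑ a : V → A, f fun v => (s v, a v) := by
  rw [← Fintype.sum_prod_type' (f := fun (s : V → L) (a : V → A) => f fun v => (s v, a v))]
  exact Fintype.sum_equiv (Equiv.arrowProdEquivProdArrow V (fun _ => L) (fun _ => A)) _ _ fun _ => rfl

theorem onSpins_one {A : Type*} [Fintype A] [DecidableEq A] :
    onSpins (1 : Op V (Fin 2)) = (1 : Op V (Fin 2 × A)) := by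
  ext x y
  simp only [onSpins, Matrix.one_apply, ← ite_and, mul_ite, mul_one, mul_zero]
  congr 1
  simp only [funext_iff, Prod.ext_iff, forall_and, eq_iff_iff]
  tauto

/-- Layers may be empty. Hence the local step of the gate teleportation is admissible at every
depth. -/
theorem IsLU.isCircuit {A : Type*} [Fintype A] [DecidableEq A] (G : SimpleGraph V)
    {C : Op V (Fin 2 × A)} (hC : IsLU C) (ℓ : ℕ) : IsCircuit G ℓ C := by
  induction ℓ with
  | zero => exact .zero C hC
  | succ n ih =>
    have h := IsCircuit.succ n C 1 1 ih ⟨[], by simp, by simp⟩ IsLU.one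
    rwa [onSpins_one, one_mul, one_mul] at h

end LocalOperators

/-! ### Pauli matrices of one qubit, their labelling by bits, and the Hadamard change of basis. -/

section SinglePauli

/-- The sign by which two Pauli matrices commute or anticommute. -/
def Pauli.sign : Pauli → Pauli → ℂ
  | .I, _ => 1
  | _, .I => 1
  | .X, .X => 1
  | .Y, .Y => 1
  | .Z, .Z => 1
  | _, _ => -1

theorem Pauli.mat_mul_comm (p q : Pauli) : p.mat * q.mat = p.sign q • (q.mat * p.mat) := by
  ext i j
  cases p <;> cases q <;> fin_cases i <;> fin_cases j <;> simp [Pauli.mat, Pauli.sign]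

theorem Pauli.sign_eq (p q : Pauli) : p.sign q = 1 ∨ p.sign q = -1 := by
  cases p <;> cases q <;> simp [Pauli.sign]

theorem Pauli.sign_self (p : Pauli) : p.sign p = 1 := by
  cases p <;> rfl

theorem Pauli.sign_I_left (p : Pauli) : Pauli.sign .I p = 1 := by
  cases p <;> rfl

theorem Pauli.sign_I_right (p : Pauli) : p.sign .I = 1 := by
  cases p <;> rfl

theorem Pauli.mat_conjTranspose (p : Pauli) : p.matᴴ = p.mat := by
  ext i j
  cases p <;> fin_cases i <;> fin_cases j <;> simp [Pauli.mat]

theorem Pauli.mat_mul_self (p : Pauli) : p.mat * p.mat = 1 := by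
  ext i j
  cases p <;> fin_cases i <;> fin_cases j <;> simp [Pauli.mat]

/-- The sign `(-1) ^ (b * x)`. -/
def bitSign (b x : Fin 2) : ℂ := if b = 1 ∧ x = 1 then -1 else 1

/-- The Pauli matrix proportional to `Z ^ b * X ^ a`. -/
def Pauli.ofBits : Fin 2 → Fin 2 → Pauli
  | 0, 0 => .I
  | 0, 1 => .Z
  | 1, 0 => .X
  | 1, 1 => .Y

/-- The factor between `Pauli.ofBits a b` and `Z ^ b * X ^ a`. -/
def bitPhase (a b : Fin 2) : ℂ := if a = 1 ∧ b = 1 then -Complex.I else 1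

theorem norm_bitPhase (a b : Fin 2) : ‖bitPhase a b‖ = 1 := by
  unfold bitPhase; split_ifs <;> simp

theorem norm_bitSign (a b : Fin 2) : ‖bitSign a b‖ = 1 := by
  unfold bitSign; split_ifs <;> simp

theorem star_bitSign (a b : Fin 2) : star (bitSign a b) = bitSign a b := by
  unfold bitSign; split_ifs <;> simp

theorem bitSign_mul_self (a b : Fin 2) : bitSign a b * bitSign a b = 1 := by
  unfold bitSign; split_ifs <;> simp

theorem bitSign_add (a b x : Fin 2) : bitSign (a + b) x = bitSign a x * bitSign b x := by
  fin_cases a <;> fin_cases b <;> fin_cases x <;> simp [bitSign]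

theorem Pauli.ofBits_mat (a b x y : Fin 2) :
    (Pauli.ofBits a b).mat x y = if y = x + a then bitPhase a b * bitSign b x else 0 := by
  fin_cases a <;> fin_cases b <;> fin_cases x <;> fin_cases y <;>
    simp [Pauli.ofBits, Pauli.mat, bitPhase, bitSign]

theorem Pauli.exists_ofBits (p : Pauli) : ∃ a b, Pauli.ofBits a b = p := by
  cases p
  · exact ⟨0, 0, rfl⟩
  · exact ⟨1, 0, rfl⟩
  · exact ⟨1, 1, rfl⟩
  · exact ⟨0, 1, rfl⟩

theorem sum_bitSign_mul_bitSign (x y : Fin 2) :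
    ∑ b, bitSign b x * bitSign b y = if x = y then 2 else 0 := by
  fin_cases x <;> fin_cases y <;> norm_num [bitSign]

/-- The Hadamard matrix. -/
def hadamard : Matrix (Fin 2) (Fin 2) ℂ :=
  ((Real.sqrt 2 : ℂ)⁻¹) • !![1, 1; 1, -1]

theorem sqrt_two_pow_mul_self (n : ℕ) :
    (Real.sqrt 2 : ℂ) ^ n * (Real.sqrt 2 : ℂ) ^ n = 2 ^ n := by
  rw [← mul_pow, ← Complex.ofReal_mul, Real.mul_self_sqrt (by norm_num)]
  norm_num

theorem sqrt_two_pow_ne_zero (n : ℕ) : (Real.sqrt 2 : ℂ) ^ n ≠ 0 :=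
  pow_ne_zero _ (by simp)

theorem inv_sqrt_two_mul_self : (Real.sqrt 2 : ℂ)⁻¹ * (Real.sqrt 2 : ℂ)⁻¹ = 2⁻¹ := by
  rw [← mul_inv, ← Complex.ofReal_mul, Real.mul_self_sqrt (by norm_num)]
  norm_num

theorem hadamard_mem_unitaryGroup : hadamard ∈ unitaryGroup (Fin 2) ℂ := by
  rw [mem_unitaryGroup_iff]
  have h := inv_sqrt_two_mul_self
  ext i j
  fin_cases i <;> fin_cases j <;>
    simp [hadamard, Matrix.mul_apply, star_eq_conjTranspose] <;>
    linear_combination (2 : ℂ) * h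

/-- A local unitary that maps the eigenbasis of the Pauli matrix `Z` or `X` to the computational
basis. -/
def basisChange : Pauli → Matrix (Fin 2) (Fin 2) ℂ
  | .X => hadamard
  | _ => 1

theorem basisChange_mem_unitaryGroup (c : Pauli) : basisChange c ∈ unitaryGroup (Fin 2) ℂ := by
  cases c
  case X => exact hadamard_mem_unitaryGroup
  all_goals exact one_mem _

/-- The action of `basisChange` on the Pauli matrices. -/
def Pauli.change : Pauli → Pauli → Pauli
  | .X, .X => .Z
  | .X, .Z => .X
  | _, p => p

/-- The sign in the action of `basisChange` on the Pauli matrices. -/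
def Pauli.changeSign : Pauli → Pauli → ℂ
  | .X, .Y => -1
  | _, _ => 1

theorem Pauli.changeSign_ne_zero (c p : Pauli) : Pauli.changeSign c p ≠ 0 := by
  cases c <;> cases p <;> simp [Pauli.changeSign]

theorem Pauli.mat_mul_basisChange (c p : Pauli) :
    p.mat * basisChange c = Pauli.changeSign c p • (basisChange c * (Pauli.change c p).mat) := by
  ext i j
  cases c <;> cases p <;> fin_cases i <;> fin_cases j <;>
    simp [Pauli.mat, Pauli.changeSign, Pauli.change, basisChange, hadamard, Matrix.mul_apply,
      Fin.sum_univ_two, mul_comm]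

end SinglePauli

/-! ### Pauli strings and stabilizers. -/

section PauliStrings

variable {V : Type*} [Fintype V] [DecidableEq V]

theorem pauliString_mul_comm (p q : V → Pauli) :
    pauliString p * pauliString q =
      (∏ v, (p v).sign (q v)) • (pauliString q * pauliString p) := by
  simp only [pauliString, tensorOp_mul, ← tensorOp_smul, ← Pauli.mat_mul_comm]

theorem prod_sign_eq (p q : V → Pauli) :
    ∏ v, (p v).sign (q v) = 1 ∨ ∏ v, (p v).sign (q v) = -1 :=
  Finset.prod_induction _ (fun z : ℂ => z = 1 ∨ z = -1)
    (by rintro _ _ (rfl | rfl) (rfl | rfl) <;> simp) (Or.inl rfl) fun v _ => Pauli.sign_eq _ _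

theorem pauliString_conjTranspose (p : V → Pauli) : (pauliString p)ᴴ = pauliString p := by
  simp only [pauliString, tensorOp_conjTranspose, Pauli.mat_conjTranspose]

theorem pauliString_mul_self (p : V → Pauli) : pauliString p * pauliString p = 1 := by
  simp only [pauliString, tensorOp_mul, Pauli.mat_mul_self, tensorOp_one]

/-- `φ` is an eigenvector of the Pauli string `p`. -/
def Stabilizes (p : V → Pauli) (φ : State V (Fin 2)) : Prop :=
  ∃ c : ℂ, pauliString p *ᵥ φ = c • φ

theorem IsNormalized.ne_zero {φ : State V (Fin 2)} (h : IsNormalized φ) : φ ≠ 0 := by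
  rintro rfl
  simp [IsNormalized] at h

theorem eigenvalue_mul_self {φ : State V (Fin 2)} (hφ : φ ≠ 0) {p : V → Pauli} {c : ℂ}
    (h : pauliString p *ᵥ φ = c • φ) : c * c = 1 := by
  have h1 : (c * c) • φ = (1 : ℂ) • φ := by
    rw [mul_smul, ← h, ← mulVec_smul, ← h, mulVec_mulVec, pauliString_mul_self, one_mulVec,
      one_smul]
  exact smul_left_injective ℂ hφ h1

/-- On a common eigenvector both orders of the product give the same eigenvalue, which is nonzero,
so anticommutation is impossible. -/
theorem prod_sign_eq_one_of_stabilizes {φ : State V (Fin 2)} (hφ : φ ≠ 0) {p q : V → Pauli}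
    (hp : Stabilizes p φ) (hq : Stabilizes q φ) : ∏ v, (p v).sign (q v) = 1 := by
  obtain ⟨c, hc⟩ := hp
  obtain ⟨d, hd⟩ := hq
  have hc0 := eigenvalue_mul_self hφ hc
  have hd0 := eigenvalue_mul_self hφ hd
  have h := congrArg (· *ᵥ φ) (pauliString_mul_comm p q)
  simp only [smul_mulVec, ← mulVec_mulVec, hc, hd, mulVec_smul, smul_smul] at h
  have h1 := smul_left_injective ℂ hφ h
  linear_combination (-c * d) * h1 - ((∏ v, (p v).sign (q v)) - 1) * d * d * hc0 -
    ((∏ v, (p v).sign (q v)) - 1) * hd0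

/-- The expectation value of a Pauli string in a stabilizer state vanishes, unless the string is a
stabilizer. -/
theorem IsStabilizerState.stabilizes_or_expectation_eq_zero {φ : State V (Fin 2)}
    (hφ : IsStabilizerState φ) (p : V → Pauli) :
    Stabilizes p φ ∨ star φ ⬝ᵥ (pauliString p *ᵥ φ) = 0 := by
  obtain ⟨hn, S, ev, -, hev, huniq⟩ := hφ
  -- If `p` commutes with all of `S`, it preserves the joint eigenspace, which is spanned by `φ`.
  -- Otherwise some `s` in `S` anticommutes with `p`, and moving `s` through the expectation value
  -- shows that it equals its own negative.
  by_cases hcomm : ∀ s ∈ S, ∏ v, (s v).sign (p v) = 1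
  · refine Or.inl (huniq _ fun s hs => ?_)
    rw [mulVec_mulVec, pauliString_mul_comm, hcomm s hs, one_smul, ← mulVec_mulVec, hev s hs,
      mulVec_smul]
  · push Not at hcomm
    obtain ⟨s, hs, hsp⟩ := hcomm
    have hanti := pauliString_mul_comm s p
    rw [(prod_sign_eq s p).resolve_left hsp] at hanti
    have he := eigenvalue_mul_self hn.ne_zero (hev s hs)
    have hstar : star (ev s) = ev s := by
      rcases mul_self_eq_one_iff.mp he with h | h <;> simp [h]
    right
    have h1 : star φ ⬝ᵥ ((pauliString s * pauliString p) *ᵥ φ) =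
        ev s * (star φ ⬝ᵥ (pauliString p *ᵥ φ)) := by
      rw [← mulVec_mulVec, dotProduct_mulVec, ← pauliString_conjTranspose s, ← star_mulVec,
        hev s hs, star_smul, smul_dotProduct, hstar, smul_eq_mul]
    rw [hanti, smul_mulVec, ← mulVec_mulVec, hev s hs, mulVec_smul, dotProduct_smul,
      dotProduct_smul, smul_eq_mul, smul_eq_mul] at h1
    linear_combination (-1 / 2 * ev s) * h1 - (star φ ⬝ᵥ (pauliString p *ᵥ φ)) * he

/-- At each site one of the two bases `X` and `Z` can be chosen such that no nontrivial product of
the chosen Pauli matrices stabilizes a given state. -/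
theorem exists_basis_avoiding_stabilizers {φ : State V (Fin 2)} (hφ : φ ≠ 0) :
    ∃ c : V → Pauli, (∀ v, c v = .X ∨ c v = .Z) ∧
      ∀ p : V → Pauli, (∀ v, p v = .I ∨ p v = c v) → Stabilizes p φ → ∀ v, p v = .I := by
  -- Induction on the set `T` of sites on which `p` may be nontrivial.
  suffices h : ∀ T : Finset V, ∃ c : V → Pauli, (∀ v, c v = .X ∨ c v = .Z) ∧
      ∀ p : V → Pauli, (∀ v, p v = .I ∨ v ∈ T ∧ p v = c v) → Stabilizes p φ → ∀ v, p v = .I by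
    simpa using h Finset.univ
  intro T
  induction T using Finset.induction_on with
  | empty => exact ⟨fun _ => .X, fun _ => Or.inl rfl, fun p hp _ v => by simpa using hp v⟩
  | insert w T hw ih =>
    obtain ⟨c, hc, ih⟩ := ih
    -- The choice `e` at the new site `w` can fail only through a stabilizer that equals `e` at `w`:
    -- one that is trivial at `w` is excluded by the induction hypothesis.
    have key : ∀ e : Pauli, (∃ p : V → Pauli, p w = e ∧
        (∀ v, v ≠ w → p v = .I ∨ p v = c v) ∧ Stabilizes p φ) ∨
        ∀ p : V → Pauli, (∀ v, p v = .I ∨ v ∈ insert w T ∧ p v = Function.update c w e v) →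
          Stabilizes p φ → ∀ v, p v = .I := by
      intro e
      by_contra! h
      obtain ⟨h1, p, hp, hs, v, hv⟩ := h
      by_cases hpw : p w = .I
      · refine hv (ih p (fun u => ?_) hs v)
        by_cases huw : u = w
        · subst huw; exact Or.inl hpw
        · simpa [huw] using hp u
      · refine h1 p ?_ (fun u huw => ?_) hs
        · simpa [hpw] using hp w
        · have := hp u
          simp only [huw, Finset.mem_insert, false_or, ne_eq, not_false_eq_true,
            Function.update_of_ne] at this
          tauto
    have upd : ∀ e : Pauli, (e = .X ∨ e = .Z) →
        ∀ v, Function.update c w e v = .X ∨ Function.update c w e v = .Z := by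
      intro e he v
      by_cases hvw : v = w
      · subst hvw; simpa using he
      · simpa [hvw] using hc v
    rcases key .X with ⟨p, hpw, hp, hps⟩ | h
    · rcases key .Z with ⟨q, hqw, hq, hqs⟩ | h
      -- If both choices fail, the two obstructing stabilizers anticommute at `w` and commute at
      -- every other site, so they anticommute.
      · exfalso
        have h1 := prod_sign_eq_one_of_stabilizes hφ hps hqs
        rw [Finset.prod_eq_single w, hpw, hqw] at h1
        · norm_num [Pauli.sign] at h1
        · intro v _ hvw
          rcases hp v hvw with h | h <;> rcases hq v hvw with h' | h' <;>
            rw [h, h'] <;> simp only [Pauli.sign_self, Pauli.sign_I_right, Pauli.sign_I_left]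
        · simp
      · exact ⟨_, upd .Z (Or.inr rfl), h⟩
    · exact ⟨_, upd .X (Or.inl rfl), h⟩

/-! ### Fourier analysis on bit strings and the matrix entries of Pauli strings. -/

/-- The sign `(-1) ^ (b · x)`. -/
def character (b x : V → Fin 2) : ℂ := ∏ v, bitSign (b v) (x v)

theorem norm_character (b x : V → Fin 2) : ‖character b x‖ = 1 := by
  simp [character, norm_prod, norm_bitSign]

theorem star_character (b x : V → Fin 2) : star (character b x) = character b x := by
  simp only [character, star_prod, star_bitSign]

theorem character_mul_self (b x : V → Fin 2) : character b x * character b x = 1 := by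
  simp only [character, ← Finset.prod_mul_distrib, bitSign_mul_self, Finset.prod_const_one]

theorem sum_character_mul_character (x y : V → Fin 2) :
    ∑ b, character b x * character b y = if x = y then 2 ^ Fintype.card V else 0 := by
  have h := Finset.prod_univ_sum (fun _ : V => (Finset.univ : Finset (Fin 2)))
    fun v b => bitSign b (x v) * bitSign b (y v)
  simp only [Fintype.piFinset_univ, Finset.prod_mul_distrib, sum_bitSign_mul_bitSign,
    Finset.prod_ite_zero, Finset.prod_const, Finset.card_univ, Finset.mem_univ,
    true_imp_iff] at h
  simp only [character, ← h, funext_iff]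

theorem fourier_inversion (F : (V → Fin 2) → ℂ) (x : V → Fin 2) :
    ∑ b, character b x * ∑ y, character b y * F y = 2 ^ Fintype.card V * F x := by
  simp only [Finset.mul_sum]
  rw [Finset.sum_comm]
  simp only [← mul_assoc, ← Finset.sum_mul, sum_character_mul_character]
  simp

/-- The Pauli string proportional to `Z ^ b * X ^ a`. -/
def bitString (a b : V → Fin 2) : V → Pauli := fun v => Pauli.ofBits (a v) (b v)

theorem exists_bitString (p : V → Pauli) : ∃ a b, bitString a b = p := by
  choose a b h using fun v => (p v).exists_ofBits
  exact ⟨a, b, funext h⟩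

/-- The factor between the Pauli string of `bitString a b` and `Z ^ b * X ^ a`. -/
def stringPhase (a b : V → Fin 2) : ℂ := ∏ v, bitPhase (a v) (b v)

theorem norm_stringPhase (a b : V → Fin 2) : ‖stringPhase a b‖ = 1 := by
  simp [stringPhase, norm_prod, norm_bitPhase]

theorem stringPhase_ne_zero (a b : V → Fin 2) : stringPhase a b ≠ 0 := by
  rw [← norm_pos_iff, norm_stringPhase]; exact one_pos

theorem pauliString_bitString (a b x y : V → Fin 2) :
    pauliString (bitString a b) x y =
      if y = x + a then stringPhase a b * character b x else 0 := by
  simp only [pauliString, tensorOp, bitString, Pauli.ofBits_mat, Finset.prod_ite_zero,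
    Finset.prod_mul_distrib, Finset.mem_univ, true_imp_iff, funext_iff, Pi.add_apply,
    stringPhase, character]

theorem pauliString_bitString_mulVec (a b : V → Fin 2) (ψ : State V (Fin 2)) (x : V → Fin 2) :
    (pauliString (bitString a b) *ᵥ ψ) x = stringPhase a b * character b x * ψ (x + a) := by
  simp [mulVec, dotProduct, pauliString_bitString]

theorem stringPhase_zero_left (b : V → Fin 2) : stringPhase 0 b = 1 := by
  simp [stringPhase, bitPhase]

/-! ### Quadratic phases, their Clifford property, and the normal form of stabilizer states. -/

/-- The translates of `g` are, up to phases, the products of `g` with characters. -/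
def IsQuadraticPhase (g : (V → Fin 2) → ℂ) : Prop :=
  (∀ x, ‖g x‖ = 1) ∧ ∀ a, ∃ (b : V → Fin 2) (c : ℂ), ‖c‖ = 1 ∧
    ∀ x, g (x + a) = c * character b x * g x

/-- Pauli corrections require `U * s * Uᴴ` instead of `Uᴴ * s * U`; for a diagonal `U` the two are
exchanged by conjugating `g`. -/
theorem IsQuadraticPhase.conj {g : (V → Fin 2) → ℂ} (hg : IsQuadraticPhase g) :
    IsQuadraticPhase (star g) := by
  refine ⟨fun x => by simp [hg.1], fun a => ?_⟩
  obtain ⟨b, c, hc, h⟩ := hg.2 a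
  exact ⟨b, star c, by simp [hc], fun x => by
    rw [Pi.star_apply, Pi.star_apply, h, star_mul', star_mul', star_character]⟩

theorem IsQuadraticPhase.star_mul {g : (V → Fin 2) → ℂ} (hg : IsQuadraticPhase g)
    (x : V → Fin 2) : star (g x) * g x = 1 := by
  rw [RCLike.star_def, RCLike.conj_mul, hg.1]
  simp

theorem IsQuadraticPhase.diagonal_mem_unitaryGroup {g : (V → Fin 2) → ℂ}
    (hg : IsQuadraticPhase g) : diagonal g ∈ unitaryGroup (V → Fin 2) ℂ := by
  rw [mem_unitaryGroup_iff', star_eq_conjTranspose, diagonal_conjTranspose, diagonal_mul_diagonal,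
    ← diagonal_one]
  exact congrArg _ (funext hg.star_mul)

/-- Conjugation with a quadratic phase maps Pauli strings to Pauli strings. -/
theorem IsQuadraticPhase.conj_pauliString {g : (V → Fin 2) → ℂ} (hg : IsQuadraticPhase g)
    (p : V → Pauli) : ∃ (q : V → Pauli) (c : ℂ), ‖c‖ = 1 ∧
      (diagonal g)ᴴ * pauliString p * diagonal g = c • pauliString q := by
  obtain ⟨a, b, rfl⟩ := exists_bitString p
  obtain ⟨d, c, hc, h⟩ := hg.2 a
  -- Conjugation multiplies the entry at `(x, x + a)` by `star (g x) * g (x + a)`, which is `c *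
  -- character d x`. This adds `d` to the `Z` part; the two string phases account for the factors in
  -- the labelling by bits.
  refine ⟨bitString a (b + d), c * stringPhase a b * (stringPhase a (b + d))⁻¹,
    by simp [hc, norm_stringPhase], ?_⟩
  ext x y
  rw [diagonal_conjTranspose, mul_diagonal, diagonal_mul, Matrix.smul_apply,
    pauliString_bitString, pauliString_bitString]
  split_ifs with hy
  · subst hy
    have hadd : character (b + d) x = character b x * character d x := by
      simp only [character, Pi.add_apply, bitSign_add, Finset.prod_mul_distrib]
    have h0 := stringPhase_ne_zero a (b + d)
    rw [h, hadd, Pi.star_apply, smul_eq_mul]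
    field_simp
    linear_combination (stringPhase a b * character b x * c * character d x) * hg.star_mul x
  · simp

theorem IsQuadraticPhase.isClifford {g : (V → Fin 2) → ℂ} (hg : IsQuadraticPhase g) :
    IsClifford (diagonal g) :=
  ⟨hg.diagonal_mem_unitaryGroup, fun p =>
    let ⟨q, c, _, h⟩ := hg.conj_pauliString p
    ⟨q, c, h⟩⟩

theorem pauliString_mul_tensorOp_basisChange (c p : V → Pauli) :
    pauliString p * tensorOp (fun v => basisChange (c v)) =
      (∏ v, (c v).changeSign (p v)) • (tensorOp (fun v => basisChange (c v)) *
        pauliString fun v => (c v).change (p v)) := by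
  simp only [pauliString, tensorOp_mul, ← tensorOp_smul, ← Pauli.mat_mul_basisChange]

theorem star_tensorOp_mulVec_dotProduct {u : V → Matrix (Fin 2) (Fin 2) ℂ}
    (hu : ∀ v, u v ∈ unitaryGroup (Fin 2) ℂ) (φ ψ : State V (Fin 2)) :
    star (tensorOp u *ᵥ φ) ⬝ᵥ (tensorOp u *ᵥ ψ) = star φ ⬝ᵥ ψ := by
  rw [star_mulVec, ← dotProduct_mulVec, mulVec_mulVec, tensorOp_conjTranspose_mul_self hu,
    one_mulVec]

theorem IsNormalized.star_dotProduct_self {φ : State V (Fin 2)} (h : IsNormalized φ) :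
    star φ ⬝ᵥ φ = 1 := by
  have h' := congrArg (fun r : ℝ => (r : ℂ)) h
  simpa [dotProduct, RCLike.conj_mul] using h'

/-- A stabilizer state is, up to a local change of basis and the normalisation, a quadratic
phase. -/
theorem IsStabilizerState.exists_isQuadraticPhase {φ : State V (Fin 2)}
    (hφ : IsStabilizerState φ) :
    ∃ u : V → Matrix (Fin 2) (Fin 2) ℂ, (∀ v, u v ∈ unitaryGroup (Fin 2) ℂ) ∧
      IsQuadraticPhase fun x =>
        (Real.sqrt 2 : ℂ) ^ Fintype.card V * (tensorOp u *ᵥ φ) x := by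
  have hn := hφ.1
  obtain ⟨c, hc, havoid⟩ := exists_basis_avoiding_stabilizers hn.ne_zero
  have hu : ∀ v, basisChange (c v) ∈ unitaryGroup (Fin 2) ℂ :=
    fun v => basisChange_mem_unitaryGroup _
  refine ⟨fun v => basisChange (c v), hu, ?_⟩
  set K := tensorOp fun v => basisChange (c v) with hK
  set χ := K *ᵥ φ with hχ
  have hmul : ∀ p, pauliString p *ᵥ χ = (∏ v, (c v).changeSign (p v)) •
      (K *ᵥ (pauliString (fun v => (c v).change (p v)) *ᵥ φ)) := fun p => by
    rw [hχ, mulVec_mulVec, hK, pauliString_mul_tensorOp_basisChange, smul_mulVec, mulVec_mulVec]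
  have hinj : ∀ ψ : State V (Fin 2), Kᴴ *ᵥ (K *ᵥ ψ) = ψ := fun ψ => by
    rw [mulVec_mulVec, hK, tensorOp_conjTranspose_mul_self hu, one_mulVec]
  have hsign : ∀ p : V → Pauli, ∏ v, (c v).changeSign (p v) ≠ 0 := fun p =>
    Finset.prod_ne_zero_iff.mpr fun v _ => Pauli.changeSign_ne_zero _ _
  -- The basis change permutes Pauli strings up to sign, so the dichotomy passes from `φ` to `χ`.
  have hdich : ∀ p, Stabilizes p χ ∨ star χ ⬝ᵥ (pauliString p *ᵥ χ) = 0 := by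
    intro p
    rcases hφ.stabilizes_or_expectation_eq_zero fun v => (c v).change (p v) with ⟨d, hd⟩ | h0
    · left
      exact ⟨(∏ v, (c v).changeSign (p v)) * d, by rw [hmul, hd, mulVec_smul, smul_smul]⟩
    · right
      rw [hmul, dotProduct_smul, star_tensorOp_mulVec_dotProduct hu, h0, smul_zero]
  -- Undoing the basis change turns a `Z`-string into a product of the chosen matrices `c v`.
  have hz : ∀ b, Stabilizes (bitString 0 b) χ → b = 0 := by
    rintro b ⟨d, hd⟩
    have hcases : ∀ v, (c v).change (bitString 0 b v) = .I ∨
        (c v).change (bitString 0 b v) = c v := by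
      intro v
      have hb : b v = 0 ∨ b v = 1 := by omega
      rcases hb with hb | hb <;> rcases hc v with h | h <;>
        simp [bitString, hb, h, Pauli.change, Pauli.ofBits]
    have hst : Stabilizes (fun v => (c v).change (bitString 0 b v)) φ := by
      refine ⟨(∏ v, (c v).changeSign (bitString 0 b v))⁻¹ * d, ?_⟩
      have h := congrArg (Kᴴ *ᵥ ·) ((hmul _).symm.trans hd)
      simp only [mulVec_smul, hinj, hχ] at h
      rw [mul_smul, ← h, inv_smul_smul₀ (hsign _)]
    funext v
    have h := havoid _ hcases hst v
    have hb : b v = 0 ∨ b v = 1 := by omega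
    rcases hb with hb | hb
    · exact hb
    · rcases hc v with h' | h' <;> simp [bitString, hb, h', Pauli.change, Pauli.ofBits] at h
  have hexp : ∀ a b, star χ ⬝ᵥ (pauliString (bitString a b) *ᵥ χ) =
      stringPhase a b * ∑ x, character b x * (star (χ x) * χ (x + a)) := by
    intro a b
    simp only [dotProduct, pauliString_bitString_mulVec, Finset.mul_sum, Pi.star_apply]
    exact Finset.sum_congr rfl fun x _ => by ring
  -- All Fourier coefficients of `|χ|²` vanish except the one at `b = 0`, which is the squared norm.
  have hflat : ∀ x, 2 ^ Fintype.card V * (star (χ x) * χ x) = 1 := by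
    intro x
    have h := fourier_inversion (fun y => star (χ y) * χ y) x
    rw [← h, Finset.sum_eq_single 0]
    · have h1 : ∀ y : V → Fin 2, character 0 y = 1 := fun y => by simp [character, bitSign]
      simp only [h1, one_mul]
      have h2 : star χ ⬝ᵥ χ = 1 := by
        rw [hχ, star_tensorOp_mulVec_dotProduct hu, hn.star_dotProduct_self]
      exact h2
    · intro b _ hb
      have h1 := (hdich (bitString 0 b)).resolve_left fun h => hb (hz b h)
      rw [hexp, stringPhase_zero_left, one_mul] at h1
      simp only [add_zero] at h1
      rw [h1, mul_zero]
    · simp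
  have hχ0 : ∀ x, χ x ≠ 0 := fun x hx => by simpa [hx] using hflat x
  have hnorm : ∀ x, ‖(Real.sqrt 2 : ℂ) ^ Fintype.card V * χ x‖ = 1 := by
    intro x
    have h1 : ‖(2 : ℂ) ^ Fintype.card V * (star (χ x) * χ x)‖ = 1 := by rw [hflat]; simp
    rw [← sqrt_two_pow_mul_self, norm_mul, norm_mul, norm_mul, norm_star] at h1
    rw [norm_mul]
    have h2 : (‖(Real.sqrt 2 : ℂ) ^ Fintype.card V‖ * ‖χ x‖) ^ 2 = 1 := by
      rw [← h1]; ring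
    exact (pow_eq_one_iff_of_nonneg (by positivity) two_ne_zero).mp h2
  refine ⟨hnorm, fun a => ?_⟩
  -- Otherwise every Fourier coefficient of `y ↦ star (χ y) * χ (y + a)` would vanish, although this
  -- function has no zeros.
  obtain ⟨b, d, hd⟩ : ∃ b, Stabilizes (bitString a b) χ := by
    by_contra! hno
    have h := fourier_inversion (fun y => star (χ y) * χ (y + a)) 0
    rw [Finset.sum_eq_zero] at h
    · have h2 : (2 : ℂ) ^ Fintype.card V ≠ 0 := pow_ne_zero _ two_ne_zero
      rcases mul_eq_zero.mp h.symm with h | h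
      · exact h2 h
      · exact (mul_ne_zero (star_ne_zero.mpr (hχ0 _)) (hχ0 _)) h
    · intro b _
      have h1 := (hdich (bitString a b)).resolve_left (hno b)
      rw [hexp] at h1
      rw [(mul_eq_zero.mp h1).resolve_left (stringPhase_ne_zero _ _), mul_zero]
  have hrel : ∀ x, χ (x + a) = (stringPhase a b)⁻¹ * d * character b x * χ x := by
    intro x
    have h := congrFun hd x
    rw [pauliString_bitString_mulVec, Pi.smul_apply, smul_eq_mul] at h
    have h0 := stringPhase_ne_zero a b
    have h1 := character_mul_self b x
    field_simp
    linear_combination character b x * h - stringPhase a b * χ (x + a) * h1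
  refine ⟨b, (stringPhase a b)⁻¹ * d, ?_, fun x => by simp only [hrel]; ring⟩
  have h1 := hnorm (0 + a)
  rw [hrel, mul_left_comm, norm_mul, hnorm 0, norm_mul, norm_character, mul_one, mul_one] at h1
  exact h1

end PauliStrings

/-! ### Choi states of diagonal unitaries and Bell measurements. -/

section ChoiState

variable {V : Type*} [Fintype V] [DecidableEq V]

theorem choiState_diagonal (g : (V → Fin 2) → ℂ) :
    choiState (diagonal g) = fun x => if (fun v => (x v).1) = fun v => (x v).2 then
      g (fun v => (x v).1) / (Real.sqrt 2 : ℂ) ^ Fintype.card V else 0 := by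
  have hbell : ∀ s a : V → Fin 2, ∏ v, bell Pauli.I (s v, a v) =
      if s = a then ((Real.sqrt 2 : ℂ) ^ Fintype.card V)⁻¹ else 0 := by
    intro s a
    have h : ∀ x y : Fin 2, bell Pauli.I (x, y) = if x = y then (Real.sqrt 2 : ℂ)⁻¹ else 0 := by
      intro x y
      fin_cases x <;> fin_cases y <;> simp [bell, Pauli.mat]
    simp [h, Finset.prod_ite_zero, funext_iff]
  funext x
  simp only [choiState, mulVec, dotProduct, sum_fun_prod, onSpins, hbell, diagonal_apply,
    ite_mul, mul_ite, zero_mul, mul_zero, mul_one, Finset.sum_ite_eq, Finset.sum_ite_eq',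
    Finset.mem_univ, if_true, eq_comm, div_eq_mul_inv]

theorem isMaximallyEntangled_choiState_diagonal {g : (V → Fin 2) → ℂ}
    (hg : ∀ x, ‖g x‖ = 1) : IsMaximallyEntangled (choiState (diagonal g)) := by
  ext s t
  rw [choiState_diagonal, traceAncillas, Matrix.smul_apply, Matrix.one_apply]
  by_cases hst : s = t
  · subst hst
    have h : g s * (starRingEnd ℂ) (g s) = 1 := by rw [RCLike.mul_conj, hg]; simp
    have h2 := sqrt_two_pow_mul_self (Fintype.card V)
    have h3 := sqrt_two_pow_ne_zero (Fintype.card V)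
    simp only [Finset.sum_ite_eq, ite_mul, zero_mul, Finset.mem_univ, if_true, smul_eq_mul,
      RCLike.star_def, map_div₀, map_pow, Complex.conj_ofReal, mul_one]
    rw [div_mul_div_comm, h, h2]
  · simp [hst, Ne.symm hst]

/-- Teleportation: the Pauli error acts before `U`. The Choi state has equal bits in `a` and `a'`,
and hermiticity of the Pauli matrices removes the conjugation of the bra. -/
theorem afterBellMeasurement_choiState_diagonal (g : (V → Fin 2) → ℂ) (α : V → Pauli)
    (ψ : State V (Fin 2)) :
    afterBellMeasurement (choiState (diagonal g)) α ψ =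
      ((1 : ℂ) / 2 ^ Fintype.card V) • (diagonal g *ᵥ (pauliString α *ᵥ ψ)) := by
  funext a
  have hp : ∀ s : V → Fin 2, ∏ v, star (bell (α v) (s v, a v)) =
      pauliString α a s * ((Real.sqrt 2 : ℂ) ^ Fintype.card V)⁻¹ := by
    intro s
    have h := congrFun (congrFun (pauliString_conjTranspose α) a) s
    rw [conjTranspose_apply] at h
    rw [← h, pauliString, tensorOp, star_prod, ← inv_pow, ← Finset.card_univ,
      ← Finset.prod_const, ← Finset.prod_mul_distrib]
    refine Finset.prod_congr rfl fun v _ => ?_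
    simp [bell, div_eq_mul_inv]
  simp only [afterBellMeasurement, choiState_diagonal, mul_ite, mul_zero, Finset.sum_ite_eq,
    Finset.mem_univ, if_true, hp, Pi.smul_apply, mulVec_diagonal, smul_eq_mul]
  simp only [mulVec, dotProduct, Finset.mul_sum]
  refine Finset.sum_congr rfl fun s _ => ?_
  rw [← sqrt_two_pow_mul_self]
  have h3 := sqrt_two_pow_ne_zero (Fintype.card V)
  field_simp

/-- Bell measurements on a Choi state of a quadratic phase implement it up to Pauli corrections. -/
theorem IsQuadraticPhase.exists_correction {g : (V → Fin 2) → ℂ} (hg : IsQuadraticPhase g)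
    (α : V → Pauli) : ∃ (w : V → Pauli) (c : ℂ), ‖c‖ = 1 ∧ ∀ ψ : State V (Fin 2),
      pauliString w *ᵥ afterBellMeasurement (choiState (diagonal g)) α ψ =
        (c / 2 ^ Fintype.card V) • (diagonal g *ᵥ ψ) := by
  obtain ⟨w, c, hc, h⟩ := hg.conj.conj_pauliString α
  rw [diagonal_conjTranspose, star_star] at h
  have hu : diagonal (star g) * diagonal g = 1 := by
    have := mem_unitaryGroup_iff'.mp hg.diagonal_mem_unitaryGroup
    rwa [star_eq_conjTranspose, diagonal_conjTranspose] at this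
  -- The Pauli error before `U` becomes the Pauli string `w` after `U`, which is its own inverse.
  have hmul : diagonal g * pauliString α = c • (pauliString w * diagonal g) := by
    rw [← smul_mul_assoc, ← h, mul_assoc, hu, mul_one]
  refine ⟨w, c, hc, fun ψ => ?_⟩
  rw [afterBellMeasurement_choiState_diagonal, mulVec_smul, mulVec_mulVec, mulVec_mulVec,
    mul_assoc, hmul, mul_smul_comm, ← mul_assoc, pauliString_mul_self, one_mul, smul_mulVec, smul_smul]
  congr 1
  ring

/-- The local unitary that applies `u` to the spin and then copies it to the ancilla. -/
def copyUnitary (u : Matrix (Fin 2) (Fin 2) ℂ) : Matrix (Fin 2 × Fin 2) (Fin 2 × Fin 2) ℂ :=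
  fun x y => if x.2 = y.2 + x.1 then u x.1 y.1 else 0

theorem copyUnitary_mem_unitaryGroup {u : Matrix (Fin 2) (Fin 2) ℂ}
    (hu : u ∈ unitaryGroup (Fin 2) ℂ) : copyUnitary u ∈ unitaryGroup (Fin 2 × Fin 2) ℂ := by
  rw [mem_unitaryGroup_iff] at hu ⊢
  ext ⟨s, a⟩ ⟨t, b⟩
  have h := congrFun (congrFun hu s) t
  simp only [Matrix.mul_apply, Fin.sum_univ_two, star_apply] at h
  simp only [Matrix.mul_apply, Fintype.sum_prod_type, Fin.sum_univ_two, star_apply, copyUnitary]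
  fin_cases s <;> fin_cases t <;> fin_cases a <;> fin_cases b <;>
    first | simp; done | simpa [Matrix.one_apply] using h

theorem tensorOp_copyUnitary_mulVec (u : V → Matrix (Fin 2) (Fin 2) ℂ) (φ : State V (Fin 2)) :
    tensorOp (fun v => copyUnitary (u v)) *ᵥ tensorState φ (productState 0) =
      fun x => if (fun v => (x v).1) = fun v => (x v).2 then
        (tensorOp u *ᵥ φ) (fun v => (x v).1) else 0 := by
  funext x
  have h : ∀ s : V → Fin 2, tensorOp (fun v => copyUnitary (u v)) x (fun v => (s v, 0)) =
      if (fun v => (x v).1) = fun v => (x v).2 then tensorOp u (fun v => (x v).1) s else 0 := by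
    intro s
    simp only [tensorOp, copyUnitary, Finset.prod_ite_zero, Finset.mem_univ, true_imp_iff,
      zero_add, funext_iff, eq_comm]
  simp only [mulVec, dotProduct, sum_fun_prod, tensorState, productState, mul_ite, mul_one,
    mul_zero, Finset.sum_ite_eq', Finset.mem_univ, if_true, h, ite_mul, zero_mul]
  split_ifs <;> simp

end ChoiState

/-! ### Implementation of quadratic phases from the prepared state. -/

section GateTeleportation

variable {V : Type*} [Fintype V] [DecidableEq V]

/-- The local unitary that applies `u` to the ancilla and then adds the spin to it. -/
def addUnitary {K : Type*} [DecidableEq K] (u : Matrix (Fin 2) (Fin 2) ℂ) :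
    Matrix (Fin 2 × Fin 2 × K) (Fin 2 × Fin 2 × K) ℂ :=
  fun x y => if x.1 = y.1 ∧ x.2.2 = y.2.2 then u (x.2.1 + x.1) y.2.1 else 0

/-- `K` stands for the basis of zero further ancillas, `Fin 0 → Fin 2`, which has one element. -/
theorem addUnitary_mem_unitaryGroup {K : Type*} [DecidableEq K] [Unique K] [Fintype K]
    {u : Matrix (Fin 2) (Fin 2) ℂ} (hu : u ∈ unitaryGroup (Fin 2) ℂ) :
    addUnitary (K := K) u ∈ unitaryGroup (Fin 2 × Fin 2 × K) ℂ := by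
  rw [mem_unitaryGroup_iff] at hu ⊢
  ext ⟨s, a, k⟩ ⟨t, b, l⟩
  have h := congrFun (congrFun hu (a + s)) (b + t)
  simp only [Matrix.mul_apply, Fin.sum_univ_two, star_apply] at h
  obtain rfl := Unique.eq_default k
  obtain rfl := Unique.eq_default l
  simp only [Matrix.mul_apply, Fintype.sum_prod_type, Fin.sum_univ_two, star_apply, addUnitary,
    Fintype.sum_unique]
  fin_cases s <;> fin_cases t <;> fin_cases a <;> fin_cases b <;>
    first | simp; done | simpa [Matrix.one_apply] using h

theorem tensorOp_addUnitary_mulVec {K : Type*} [DecidableEq K] [Unique K] [Fintype K]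
    (u : V → Matrix (Fin 2) (Fin 2) ℂ) (φ ψ : State V (Fin 2)) (l : K) (s : V → Fin 2)
    (a : V → Fin 2 × K) :
    (tensorOp (fun v => addUnitary (u v)) *ᵥ
      tensorState ψ (tensorState φ (productState l))) (fun v => (s v, a v)) =
      ψ s * (tensorOp u *ᵥ φ) (s + fun v => (a v).1) := by
  have h : ∀ (t b : V → Fin 2) (k : V → K),
      tensorOp (fun v => addUnitary (K := K) (u v)) (fun v => (s v, a v))
        (fun v => (t v, b v, k v)) =
      if s = t then tensorOp u (s + fun v => (a v).1) b else 0 := by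
    intro t b k
    have hk : ∀ v, (a v).2 = k v := fun v => Subsingleton.elim _ _
    simp only [tensorOp, addUnitary, Finset.prod_ite_zero, Finset.mem_univ, true_imp_iff,
      hk, and_true, funext_iff, Pi.add_apply, add_comm]
  have hprod : ∀ k : V → K, productState l k = 1 := fun k => by
    simp [productState, Subsingleton.elim k fun _ => l]
  simp only [mulVec, dotProduct, sum_fun_prod, tensorState, h, hprod, Fintype.sum_unique,
    ite_mul, zero_mul, mul_one]
  rw [Finset.sum_eq_single s]
  · simp only [if_true, Finset.mul_sum]
    exact Finset.sum_congr rfl fun b _ => by ring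
  · intro t _ ht
    simp [Ne.symm ht]
  · simp

theorem braAncillas_one {A : Type*} [Fintype A] [DecidableEq A] (α : V → A)
    (Ψ : State V (Fin 2 × A)) (s : V → Fin 2) :
    braAncillas (fun v a => (1 : Matrix A A ℂ) a (α v)) Ψ s = Ψ fun v => (s v, α v) := by
  have h : ∀ a : V → A, ∏ v, star ((1 : Matrix A A ℂ) (a v) (α v)) = if a = α then 1 else 0 := by
    intro a
    simp only [Matrix.one_apply, apply_ite star, star_one, star_zero, Finset.prod_ite_zero,
      Finset.mem_univ, true_imp_iff, Finset.prod_const_one, funext_iff]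
  simp only [braAncillas, h, ite_mul, one_mul, zero_mul, Finset.sum_ite_eq', Finset.mem_univ,
    if_true]

/-- A quadratic phase is implemented by gate teleportation, if the corresponding state can be
prepared. -/
theorem IsQuadraticPhase.mem_unitaryQCcc {G : SimpleGraph V} {ℓ : ℕ} {φ : State V (Fin 2)}
    (hprep : PreparableQCcc G ℓ φ) {u : V → Matrix (Fin 2) (Fin 2) ℂ}
    (hu : ∀ v, u v ∈ unitaryGroup (Fin 2) ℂ) {r : ℂ} (hr : r ≠ 0)
    (hg : IsQuadraticPhase fun x => r * (tensorOp u *ᵥ φ) x) :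
    diagonal (fun x => r * (tensorOp u *ᵥ φ) x) ∈ UnitaryQCcc G ℓ := by
  choose b c _ hbc using hg.2
  -- With the ancillas measured in the computational basis, outcome `α` leaves `ψ s` times the
  -- amplitude of the rotated state at `s + α`. By the translation rule this is `c / r` times a
  -- character times `g s * ψ s`, and a `Z`-string removes the character.
  refine ⟨hg.diagonal_mem_unitaryGroup, φ, hprep, 0, tensorOp fun v => addUnitary (u v),
    fun _ => 1, fun α => pauliString (bitString 0 (b fun v => (α v).1)),
    IsLU.isCircuit G ⟨_, fun v => addUnitary_mem_unitaryGroup (hu v), rfl⟩ ℓ,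
    fun _ => one_mem _, fun α => ⟨_, fun v => ?_, rfl⟩, fun α =>
    ⟨c (fun v => (α v).1) / r, fun ψ => ?_⟩⟩
  · rw [mem_unitaryGroup_iff, star_eq_conjTranspose, Pauli.mat_conjTranspose, Pauli.mat_mul_self]
  · funext s
    rw [pauliString_bitString_mulVec, braAncillas_one, tensorOp_addUnitary_mulVec,
      stringPhase_zero_left, add_zero, Pi.smul_apply, mulVec_diagonal, smul_eq_mul, one_mul]
    have h := hbc (fun v => (α v).1) s
    have h1 := character_mul_self (b fun v => (α v).1) s
    simp only at h
    rw [div_mul_eq_mul_div, eq_div_iff hr]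
    linear_combination character (b fun v => (α v).1) s * ψ s * h +
      c (fun v => (α v).1) * r * (tensorOp u *ᵥ φ) s * ψ s * h1

end GateTeleportation

end QCLOCC

end

theorem mainTheorem7 {V : Type*} [Fintype V] [DecidableEq V] (G : SimpleGraph V) (ℓ : ℕ)
    (φ : State V (Fin 2)) (hstab : IsStabilizerState φ) (hprep : PreparableQCcc G ℓ φ) :
    ∃ (T : Op V (Fin 2 × Fin 2)) (R : State V (Fin 2 × Fin 2)) (U : Op V (Fin 2)),
      IsLU T ∧ R = T.mulVec (tensorState φ (productState 0)) ∧
      IsMaximallyEntangled R ∧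
      IsClifford U ∧ R = choiState U ∧
      U ∈ UnitaryQCcc G ℓ ∧
      ∀ α : V → Pauli, ∃ (w : V → Pauli) (c : ℂ), ‖c‖ = 1 ∧
        ∀ ψ : State V (Fin 2),
          (pauliString w).mulVec (afterBellMeasurement R α ψ) =
            (c / 2 ^ Fintype.card V) • U.mulVec ψ := by
  obtain ⟨u, hu, hg⟩ := hstab.exists_isQuadraticPhase
  refine ⟨_, _, _, ⟨_, fun v => copyUnitary_mem_unitaryGroup (hu v), rfl⟩, rfl, ?_,
    hg.isClifford, ?_, hg.mem_unitaryQCcc hprep hu (sqrt_two_pow_ne_zero _), ?_⟩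
  all_goals
    -- Both states are supported on equal spin and ancilla bits; the normalisation of the Bell pairs
    -- cancels the rescaling in `g`.
    have hR : Matrix.mulVec (tensorOp fun v => copyUnitary (u v))
        (tensorState φ (productState 0)) =
        choiState (Matrix.diagonal fun x =>
          (Real.sqrt 2 : ℂ) ^ Fintype.card V * (tensorOp u).mulVec φ x) := by
      rw [tensorOp_copyUnitary_mulVec, choiState_diagonal]
      simp only [mul_div_cancel_left₀ _ (sqrt_two_pow_ne_zero (Fintype.card V))]
  · rw [hR]
    exact isMaximallyEntangled_choiState_diagonal hg.1
  · exact hR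
  · rw [hR]
    exact hg.exists_correction
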